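/- Let $\mathcal H,\mathcal G$ be complex Hilbert spaces, let $S$ be a closed densely defined symmetric operator in $\mathcal H$, and let $(\mathcal G,\Gamma,\Gamma')$ be a boundary triplet for $S$: the maps $\Gamma,\Gamma':\operatorname{dom}S^*\to\mathcal G$ are linear, $\langle f,S^*g\rangle-\langle S^*f,g\rangle=\langle\Gamma f,\Gamma'g\rangle-\langle\Gamma'f,\Gamma g\rangle$ for all $f,g\in\operatorname{dom}S^*$, and $f\mapsto(\Gamma f,\Gamma'f)$ maps $\operatorname{dom}S^*$ onto $\mathcal G\oplus\mathcal G$. Let $H^0$ and $H$ be the restrictions of $S^*$ to $\ker\Gamma$ and to $\ker\Gamma'$. For $z\notin\operatorname{spec}H^0$ let $\gamma(z)=(\Gamma|_{\ker(S^*-z)})^{-1}:\mathcal G\to\mathcal H$ and $M(z)=\Gamma'\gamma(z)$. Let $J\subset\mathbb R\setminus\operatorname{spec}H^0$ be an open interval, and suppose that $$M(z)=\frac{m(z)-T}{n(z)}\qquad(z\notin\operatorname{spec}H^0,\ n(z)\neq0),$$ where $T$ is a bounded self-adjoint operator in $\mathcal G$ and $m,n$ are scalar functions holomorphic outside $\operatorname{spec}H^0$,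 with $n$ non-vanishing in $J$. For a self-adjoint operator $A$ let $E_A(\Omega)=1_\Omega(A)$ denote its operator-valued spectral measure. Then for every eigenvalue $\lambda\in J$ of $H$ the number $m(\lambda)$ is real, $m'(\lambda)\neq0$, and $$E_H(\{\lambda\})=\frac{n(\lambda)}{m'(\lambda)}\,\gamma(\lambda)\,E_T(\{m(\lambda)\})\,\gamma(\lambda)^*.$$ -/

import Mathlib

open scoped InnerProductSpace LinearPMap

noncomputable section

namespace SelfAdjExt

section Operators

variable {E : Type*} [NormedAddCommGroup E] [InnerProductSpace ℂ E]

/-- `R` is the everywhere defined bounded inverse of `A - z : dom A → E`. -/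
def IsResolventAt (A : E →ₗ.[ℂ] E) (z : ℂ) (R : E →L[ℂ] E) : Prop :=
  (∀ f : A.domain, R (A f - z • (f : E)) = f) ∧
    ∀ g : E, ∃ f : A.domain, (f : E) = R g ∧ A f - z • (f : E) = g

/-- The spectrum of a (possibly unbounded) operator: the set of those `z` for which `A - z` has no
everywhere defined bounded inverse. -/
def spec (A : E →ₗ.[ℂ] E) : Set ℂ :=
  {z | ¬ ∃ R : E →L[ℂ] E, IsResolventAt A z R}

open Classical in
/-- The resolvent `(A - z)⁻¹` at a point `z ∉ spec A` (and `0` at points of the spectrum). -/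
def resolventOp (A : E →ₗ.[ℂ] E) (z : ℂ) : E →L[ℂ] E :=
  if h : ∃ R : E →L[ℂ] E, IsResolventAt A z R then h.choose else 0

/-- The point spectrum of `A` on the real line: the set of real eigenvalues. -/
def pointSpec (A : E →ₗ.[ℂ] E) : Set ℝ :=
  {x | ∃ f : A.domain, (f : E) ≠ 0 ∧ A f = (x : ℂ) • (f : E)}

/-- `μ` is the (scalar) spectral measure of the vector `f` with respect to the self-adjoint
operator `A`: the finite Borel measure on `ℝ` determined by
`⟨f, (A - z)⁻¹ f⟩ = ∫ (x - z)⁻¹ dμ(x)` for all non-real `z`. -/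
def IsVectorSpectralMeasure (A : E →ₗ.[ℂ] E) (f : E) (μ : MeasureTheory.Measure ℝ) : Prop :=
  MeasureTheory.IsFiniteMeasure μ ∧
    ∀ z : ℂ, z.im ≠ 0 → ⟪f, resolventOp A z f⟫_ℂ = ∫ x : ℝ, ((x : ℂ) - z)⁻¹ ∂μ

/-- `P = 1_Ω(A)`, that is, `⟨f, P f⟩ = μ_f(Ω)` for every vector `f`, where `μ_f` is the spectral
measure of `f` with respect to `A`. -/
def IsSpectralProjection (A : E →ₗ.[ℂ] E) (Ω : Set ℝ) (P : E →L[ℂ] E) : Prop :=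
  ∀ f : E, ∃ μ : MeasureTheory.Measure ℝ,
    IsVectorSpectralMeasure A f μ ∧ ⟪f, P f⟫_ℂ = ((μ.real Ω : ℝ) : ℂ)

open Classical in
/-- The operator-valued spectral measure `Ω ↦ E_A(Ω) = 1_Ω(A)` of a self-adjoint operator `A`,
for Borel sets `Ω ⊆ ℝ`. -/
def spectralMeasure (A : E →ₗ.[ℂ] E) (Ω : Set ℝ) : E →L[ℂ] E :=
  if h : ∃ P : E →L[ℂ] E, IsSpectralProjection A Ω P then h.choose else 0

/-- A bounded operator, viewed as an operator with domain the whole space. -/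
def ofBounded (T : E →L[ℂ] E) : E →ₗ.[ℂ] E :=
  (T : E →ₗ[ℂ] E).toPMap ⊤

end Operators

section Triplets

variable {H : Type*} [NormedAddCommGroup H] [InnerProductSpace ℂ H] [CompleteSpace H]
variable {G : Type*} [NormedAddCommGroup G] [InnerProductSpace ℂ G] [CompleteSpace G]

/-- A closed densely defined symmetric operator. -/
structure IsClosedDenseSymmetric (S : H →ₗ.[ℂ] H) : Prop where
  closed : S.IsClosed
  dense : Dense (S.domain : Set H)
  symmetric : S.IsFormalAdjoint S

/-- A boundary triplet `(G, Γ, Γ')` for `S`: linear maps `Γ, Γ' : dom S* → G` that satisfy the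
abstract Green identity and are jointly surjective onto `G ⊕ G`. -/
structure BoundaryTriplet (S : H →ₗ.[ℂ] H) (G : Type*) [NormedAddCommGroup G]
    [InnerProductSpace ℂ G] where
  Γ : S†.domain →ₗ[ℂ] G
  Γ' : S†.domain →ₗ[ℂ] G
  green : ∀ f g : S†.domain,
    ⟪(f : H), S† g⟫_ℂ - ⟪S† f, (g : H)⟫_ℂ = ⟪Γ f, Γ' g⟫_ℂ - ⟪Γ' f, Γ g⟫_ℂ
  surj : Function.Surjective fun f : S†.domain => (Γ f, Γ' f)

namespace BoundaryTriplet

variable {S : H →ₗ.[ℂ] H} (t : BoundaryTriplet S G)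

/-- The reference extension `H⁰`, the restriction of `S*` to `ker Γ`. -/
def refExt : H →ₗ.[ℂ] H :=
  S†.domRestrict ((LinearMap.ker t.Γ).map S†.domain.subtype)

/-- The extension `H`, the restriction of `S*` to `ker Γ'`. -/
def ext : H →ₗ.[ℂ] H :=
  S†.domRestrict ((LinearMap.ker t.Γ').map S†.domain.subtype)

/-- `g` is the bounded inverse of the restriction of `Γ` to `ker (S* - z)`. -/
def IsGammaAt (z : ℂ) (g : G →L[ℂ] H) : Prop :=
  (∀ ξ : G, ∃ f : S†.domain, (f : H) = g ξ ∧ S† f = z • (f : H) ∧ t.Γ f = ξ) ∧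
    ∀ f : S†.domain, S† f = z • (f : H) → g (t.Γ f) = f

open Classical in
/-- The `γ`-field `γ(z) = (Γ|_{ker (S* - z)})⁻¹`, for `z ∉ spec H⁰`. -/
def gamma (z : ℂ) : G →L[ℂ] H :=
  if h : ∃ g : G →L[ℂ] H, t.IsGammaAt z g then h.choose else 0

/-- `M` is the bounded operator `Γ' γ(z)`. -/
def IsWeylAt (z : ℂ) (M : G →L[ℂ] G) : Prop :=
  ∀ ξ : G, ∃ f : S†.domain, (f : H) = t.gamma z ξ ∧ M ξ = t.Γ' f

open Classical in
/-- The Weyl function `M(z) = Γ' γ(z)`, for `z ∉ spec H⁰`. -/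
def weyl (z : ℂ) : G →L[ℂ] G :=
  if h : ∃ M : G →L[ℂ] G, t.IsWeylAt z M then h.choose else 0

end BoundaryTriplet

end Triplets

end SelfAdjExt

end

/-! Green's identity at two real points of the gap gives `(y - x) γ(x)* γ(y) = M(y) - M(x)`. If `T η
= m(x) η`, then `M(x) η = 0` and the right side sends `η` to `(m(y) - m(x)) / n(y) • η`. Dividing by
`y - x` and letting `y → x` shows that `γ(x)* γ(x)` is `m'(x) / n(x)` on `ker (T - m(x))`
(`inner_gamma_of_eigen`). The eigenspace of `H` at `λ` is `γ(λ) ker M(λ) = γ(λ) ker (T - m(λ))`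
(`mem_eigenspace_ext_iff`). So an eigenvalue `λ` of `H` makes `m(λ)` an eigenvalue of the
self-adjoint `T`, hence real; `m'(λ) = 0` would annihilate the eigenvector. With `P` the projection
onto `ker (T - m(λ))`, the operator `(n / m') γ P γ*` is then the orthogonal projection onto `γ(λ)
ker (T - m(λ))`. It remains to identify spectral measures of points, defined through Stieltjes
transforms, with projections onto eigenspaces (`spectralMeasure_singleton`). This is done for `H`
and `T` at once: `-iε (A - l - iε)⁻¹` converges strongly to the eigenprojection, and the same limit
of the Stieltjes transform is the mass at `l`. -/

noncomputable section

namespace SelfAdjExt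

/-! ### Self-adjointness and non-real resolvents -/

section Maximal

variable {E : Type*} [NormedAddCommGroup E] [InnerProductSpace ℂ E]

/-- `A` is symmetric and its graph contains the graph of its adjoint relation. -/
structure IsMaxSymm (A : E →ₗ.[ℂ] E) : Prop where
  symm : ∀ u v : A.domain, ⟪(u : E), A v⟫_ℂ = ⟪A u, (v : E)⟫_ℂ
  maximal : ∀ h k : E, (∀ u : A.domain, ⟪h, A u⟫_ℂ = ⟪k, (u : E)⟫_ℂ) →
    ∃ u : A.domain, (u : E) = h ∧ A u = k

theorem IsResolventAt.unique {A : E →ₗ.[ℂ] E} {z : ℂ} {R R' : E →L[ℂ] E}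
    (h : IsResolventAt A z R) (h' : IsResolventAt A z R') : R = R' := by
  ext g
  obtain ⟨f, hf, hg⟩ := h'.2 g
  rw [← hf, ← h.1 f, hg]

theorem IsResolventAt.resolventOp_eq {A : E →ₗ.[ℂ] E} {z : ℂ} {R : E →L[ℂ] E}
    (h : IsResolventAt A z R) : resolventOp A z = R := by
  have hex : ∃ R : E →L[ℂ] E, IsResolventAt A z R := ⟨R, h⟩
  rw [resolventOp, dif_pos hex]
  exact hex.choose_spec.unique h

theorem IsResolventAt.sub_eq {A : E →ₗ.[ℂ] E} {z w : ℂ} {R R' : E →L[ℂ] E}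
    (h : IsResolventAt A z R) (h' : IsResolventAt A w R') :
    R - R' = (z - w) • (R * R') := by
  ext g
  obtain ⟨f, hf, hg⟩ := h'.2 g
  have h1 := h.1 f
  have h2 : g = (A f - z • (f : E)) + (z - w) • (f : E) := by rw [← hg]; module
  have h3 : R g = f + (z - w) • R f := by
    conv_lhs => rw [h2]
    rw [map_add, h1, map_smul]
  simp [← hf, h3]

namespace IsMaxSymm

variable {A : E →ₗ.[ℂ] E} (hA : IsMaxSymm A)
include hA

theorem im_inner_self (u : A.domain) : (⟪(u : E), A u⟫_ℂ).im = 0 := by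
  have h := hA.symm u u
  have h2 := inner_conj_symm (𝕜 := ℂ) (u : E) (A u)
  rw [← h] at h2
  exact Complex.conj_eq_iff_im.mp h2

theorem im_mul_norm_le (z : ℂ) (u : A.domain) : |z.im| * ‖(u : E)‖ ≤ ‖A u - z • (u : E)‖ := by
  have h1 : (⟪(u : E), A u - z • (u : E)⟫_ℂ).im = - (z.im * ‖(u : E)‖ ^ 2) := by
    rw [inner_sub_right, inner_smul_right, inner_self_eq_norm_sq_to_K, Complex.sub_im,
      hA.im_inner_self]
    simp [← Complex.ofReal_pow]
  have h2 : |z.im| * ‖(u : E)‖ ^ 2 ≤ ‖(u : E)‖ * ‖A u - z • (u : E)‖ := by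
    calc |z.im| * ‖(u : E)‖ ^ 2 = |(⟪(u : E), A u - z • (u : E)⟫_ℂ).im| := by
          rw [h1, abs_neg, abs_mul, abs_of_nonneg (sq_nonneg ‖(u : E)‖)]
      _ ≤ ‖⟪(u : E), A u - z • (u : E)⟫_ℂ‖ := Complex.abs_im_le_norm _
      _ ≤ _ := norm_inner_le_norm _ _
  rcases (norm_nonneg (u : E)).eq_or_lt with h0 | h0
  · rw [← h0, mul_zero]; exact norm_nonneg _
  · refine le_of_mul_le_mul_left ?_ h0
    linarith [h2]

/-- The graph of `A` is sequentially closed. -/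
theorem exists_of_tendsto {u : ℕ → A.domain} {x y : E}
    (hx : Filter.Tendsto (fun k => (u k : E)) Filter.atTop (nhds x))
    (hy : Filter.Tendsto (fun k => A (u k)) Filter.atTop (nhds y)) :
    ∃ v : A.domain, (v : E) = x ∧ A v = y := by
  refine hA.maximal x y fun v => ?_
  refine tendsto_nhds_unique (hx.inner tendsto_const_nhds) ?_
  simp_rw [hA.symm]
  exact hy.inner tendsto_const_nhds

theorem isResolventAt_inner {z : ℂ} {R R' : E →L[ℂ] E} (h : IsResolventAt A z R)
    (h' : IsResolventAt A (starRingEnd ℂ z) R') (f g : E) : ⟪R' f, g⟫_ℂ = ⟪f, R g⟫_ℂ := by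
  obtain ⟨u, hu, huf⟩ := h'.2 f
  obtain ⟨v, hv, hvg⟩ := h.2 g
  rw [← hu, ← hv, ← huf, ← hvg, inner_sub_left, inner_sub_right, hA.symm, inner_smul_left,
    inner_smul_right, Complex.conj_conj]

/-- The bound `im_mul_norm_le` makes `A - z` injective with closed range. By maximality a vector
orthogonal to the range satisfies `A h = conj z • h`, and the same bound at `conj z` forces it to
vanish. -/
theorem exists_isResolventAt [CompleteSpace E] {z : ℂ} (hz : z.im ≠ 0) :
    ∃ R : E →L[ℂ] E, IsResolventAt A z R := by
  have hz' : 0 < |z.im| := abs_pos.mpr hz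
  let L : A.domain →ₗ[ℂ] E := A.toFun - z • A.domain.subtype
  have hL : ∀ u : A.domain, L u = A u - z • (u : E) := fun u => rfl
  have hbd : ∀ u : A.domain, ‖(u : E)‖ ≤ |z.im|⁻¹ * ‖L u‖ := fun u => by
    rw [inv_mul_eq_div, le_div_iff₀' hz']
    exact hA.im_mul_norm_le z u
  have hinj : Function.Injective L := by
    refine (injective_iff_map_eq_zero L).mpr fun u hu => ?_
    have := hbd u
    rw [hu, norm_zero, mul_zero] at this
    exact Subtype.ext (norm_le_zero_iff.mp this)
  have hclosed : IsClosed (LinearMap.range L : Set E) := by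
    refine IsSeqClosed.isClosed fun y g hy hg => ?_
    choose u hu using hy
    have hc : CauchySeq fun k => (u k : E) := by
      rw [Metric.cauchySeq_iff']
      intro ε hε
      obtain ⟨N, hN⟩ := Metric.cauchySeq_iff'.mp hg.cauchySeq (|z.im| * ε) (by positivity)
      refine ⟨N, fun k hk => ?_⟩
      have h1 := hN k hk
      rw [dist_eq_norm] at h1 ⊢
      have h2 := hbd (u k - u N)
      rw [map_sub, hu, hu, AddSubgroupClass.coe_sub] at h2
      refine h2.trans_lt ?_
      rw [inv_mul_eq_div, div_lt_iff₀' hz']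
      exact h1
    obtain ⟨x, hx⟩ := cauchySeq_tendsto_of_complete hc
    have hAu : ∀ k, A (u k) = y k + z • (u k : E) := fun k => by
      rw [← hu, hL]; module
    obtain ⟨v, hv, hv'⟩ := hA.exists_of_tendsto hx (y := g + z • x) (by
      simp_rw [hAu]; exact hg.add (hx.const_smul z))
    exact ⟨v, by rw [hL, hv, hv']; module⟩
  have hsurj : Function.Surjective L := by
    rw [← LinearMap.range_eq_top]
    have : CompleteSpace (LinearMap.range L) := hclosed.completeSpace_coe
    rw [← Submodule.orthogonal_eq_bot_iff, Submodule.eq_bot_iff]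
    intro h hh
    obtain ⟨v, hv, hv'⟩ := hA.maximal h (starRingEnd ℂ z • h) fun u => by
      have h1 := Submodule.inner_left_of_mem_orthogonal (LinearMap.mem_range_self L u) hh
      rw [hL, inner_sub_right, inner_smul_right, sub_eq_zero] at h1
      rw [h1, inner_smul_left, Complex.conj_conj]
    have h1 := hA.im_mul_norm_le (starRingEnd ℂ z) v
    rw [hv', hv, sub_self, norm_zero, Complex.conj_im, abs_neg] at h1
    exact norm_le_zero_iff.mp (nonpos_of_mul_nonpos_right h1 hz')
  let e := LinearEquiv.ofBijective L ⟨hinj, hsurj⟩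
  let R : E →L[ℂ] E := (A.domain.subtype ∘ₗ (e.symm : E →ₗ[ℂ] A.domain)).mkContinuous |z.im|⁻¹
    fun g => by
      have := hbd (e.symm g)
      have h2 : L (e.symm g) = g := e.apply_symm_apply g
      rwa [h2] at this
  refine ⟨R, fun f => ?_, fun g => ⟨e.symm g, rfl, e.apply_symm_apply g⟩⟩
  have : e.symm (L f) = f := e.symm_apply_apply f
  exact congrArg Subtype.val this

theorem isResolventAt_resolventOp [CompleteSpace E] {z : ℂ} (hz : z.im ≠ 0) :
    IsResolventAt A z (resolventOp A z) := by
  obtain ⟨R, hR⟩ := hA.exists_isResolventAt hz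
  rwa [hR.resolventOp_eq]

theorem adjoint_resolventOp [CompleteSpace E] {z : ℂ} (hz : z.im ≠ 0) :
    ContinuousLinearMap.adjoint (resolventOp A z) = resolventOp A (starRingEnd ℂ z) := by
  symm
  rw [ContinuousLinearMap.eq_adjoint_iff]
  exact hA.isResolventAt_inner (hA.isResolventAt_resolventOp hz)
    (hA.isResolventAt_resolventOp (by simpa using hz))

end IsMaxSymm

end Maximal

/-! ### Existence of scalar spectral measures -/

section Measures

open MeasureTheory

variable {E : Type*} [NormedAddCommGroup E] [InnerProductSpace ℂ E] [CompleteSpace E]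

/-- The diagonal matrix elements of a `*`-representation of `C(X, ℂ)` are integrals. -/
theorem exists_measure_inner_eq_integral {X : Type*} [TopologicalSpace X] [T2Space X]
    [CompactSpace X] [MeasurableSpace X] [BorelSpace X]
    (Φ : C(X, ℂ) →⋆ₐ[ℂ] (E →L[ℂ] E)) (f : E) :
    ∃ ν : Measure X, IsFiniteMeasure ν ∧ ∀ g : C(X, ℂ), ⟪f, Φ g f⟫_ℂ = ∫ x, g x ∂ν := by
  let c : C(X, ℝ) → C(X, ℂ) := fun g => ⟨fun x => (g x : ℂ), by fun_prop⟩
  have hc_real : ∀ g, ⟪f, Φ (c g) f⟫_ℂ = ((⟪f, Φ (c g) f⟫_ℂ).re : ℂ) := fun g => by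
    have h1 : star (c g) = c g := by ext x; simp [c]
    have h2 : ContinuousLinearMap.adjoint (Φ (c g)) = Φ (c g) := by
      rw [← ContinuousLinearMap.star_eq_adjoint, ← map_star, h1]
    refine (Complex.conj_eq_iff_re.mp ?_).symm
    rw [inner_conj_symm]
    conv_rhs => rw [← h2, ContinuousLinearMap.adjoint_inner_right]
  let Λ₀ : CompactlySupportedContinuousMap X ℝ →ₗ[ℝ] ℝ :=
    { toFun := fun g => (⟪f, Φ (c g.toContinuousMap) f⟫_ℂ).re
      map_add' := fun g h => by
        have : c (g + h).toContinuousMap = c g.toContinuousMap + c h.toContinuousMap := by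
          ext x; simp [c]
        rw [this, map_add, add_apply, inner_add_right, Complex.add_re]
      map_smul' := fun r g => by
        have : c (r • g).toContinuousMap = (r : ℂ) • c g.toContinuousMap := by
          ext x; simp [c]
        rw [this, map_smul, smul_apply, inner_smul_right,
          Complex.re_ofReal_mul]
        rfl }
  let Λ : CompactlySupportedContinuousMap X ℝ →ₚ[ℝ] ℝ := PositiveLinearMap.mk₀ Λ₀ fun g hg => by
    -- Positivity: `g = star s * s` with `s = √g`, so the form is `‖Φ s f‖²`.
    let s : C(X, ℝ) := ⟨fun x => Real.sqrt (g x), by fun_prop⟩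
    have h1 : c g.toContinuousMap = star (c s) * c s := by
      ext x
      have : 0 ≤ g x := hg x
      simp [c, s, ← Complex.ofReal_mul, Real.mul_self_sqrt this]
    change 0 ≤ (⟪f, Φ (c g.toContinuousMap) f⟫_ℂ).re
    rw [h1, map_mul, map_star, ContinuousLinearMap.star_eq_adjoint, mul_apply_eq_comp,
      ContinuousLinearMap.adjoint_inner_right, inner_self_eq_norm_sq_to_K]
    simp only [Complex.coe_algebraMap, ← Complex.ofReal_pow, Complex.ofReal_re]
    positivity
  have hfin : IsFiniteMeasure (RealRMK.rieszMeasure Λ) := by infer_instance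
  refine ⟨RealRMK.rieszMeasure Λ, hfin, fun g => ?_⟩
  have hint : ∀ h : C(X, ℝ), ⟪f, Φ (c h) f⟫_ℂ = ((∫ x, h x ∂(RealRMK.rieszMeasure Λ) : ℝ) : ℂ) :=
    fun h => by
      rw [hc_real]
      congr 1
      exact (RealRMK.integral_rieszMeasure Λ
        (CompactlySupportedContinuousMap.continuousMapEquiv h)).symm
  let gr : C(X, ℝ) := ⟨fun x => (g x).re, by fun_prop⟩
  let gi : C(X, ℝ) := ⟨fun x => (g x).im, by fun_prop⟩
  have hg : g = c gr + Complex.I • c gi := by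
    ext x
    simp [c, gr, gi, mul_comm Complex.I]
  have hgint : Integrable g (RealRMK.rieszMeasure Λ) :=
    g.continuous.integrable_of_hasCompactSupport (HasCompactSupport.of_compactSpace _)
  conv_lhs => rw [hg]
  rw [map_add, map_smul, add_apply, smul_apply,
    inner_add_right, inner_smul_right, hint, hint, ← integral_re_add_im hgint]
  simp [gr, gi, mul_comm Complex.I]

namespace IsMaxSymm

variable {A : E →ₗ.[ℂ] E} (hA : IsMaxSymm A)
include hA

theorem one_add_mul_one_sub {z w : ℂ} (hz : z.im ≠ 0) (hw : w.im ≠ 0) :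
    (1 + (z - w) • resolventOp A z) * (1 - (z - w) • resolventOp A w) = 1 := by
  have h := (hA.isResolventAt_resolventOp hz).sub_eq (hA.isResolventAt_resolventOp hw)
  have h2 : (z - w) • (resolventOp A z - resolventOp A w) =
    (z - w) • ((z - w) • (resolventOp A z * resolventOp A w)) := by rw [h]
  simp only [mul_sub, add_mul, one_mul, mul_one, smul_mul_assoc, mul_smul_comm, smul_add,
    smul_sub] at h2 ⊢
  rw [← h2]
  abel

theorem commute_resolventOp {z w : ℂ} (hz : z.im ≠ 0) (hw : w.im ≠ 0) :
    Commute (resolventOp A z) (resolventOp A w) := by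
  rcases eq_or_ne z w with rfl | h
  · exact Commute.refl _
  have h1 := (hA.isResolventAt_resolventOp hz).sub_eq (hA.isResolventAt_resolventOp hw)
  have h2 := (hA.isResolventAt_resolventOp hw).sub_eq (hA.isResolventAt_resolventOp hz)
  have h3 : (z - w) • (resolventOp A z * resolventOp A w) =
      (z - w) • (resolventOp A w * resolventOp A z) := by
    rw [← h1, ← neg_sub (resolventOp A w), h2, ← neg_smul, neg_sub]
  exact smul_right_injective _ (sub_ne_zero.mpr h) h3

theorem isStarNormal_resolventOp {z : ℂ} (hz : z.im ≠ 0) : IsStarNormal (resolventOp A z) := by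
  refine ⟨?_⟩
  rw [ContinuousLinearMap.star_eq_adjoint, hA.adjoint_resolventOp hz]
  exact hA.commute_resolventOp (by simpa using hz) hz

/-- Spectral mapping for `r = (x - i)⁻¹`: were `x = r⁻¹ + i` non-real, the resolvent at `x` would
provide an inverse of `r - (A - i)⁻¹`. -/
theorem im_inv_add_I_of_mem_spectrum {r : ℂ} (hr : r ∈ spectrum ℂ (resolventOp A Complex.I))
    (hr0 : r ≠ 0) : (r⁻¹ + Complex.I).im = 0 := by
  by_contra hz
  have hI : Complex.I.im ≠ 0 := by simp
  have h1 := hA.one_add_mul_one_sub hz hI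
  have h2 := hA.one_add_mul_one_sub hI hz
  have h3 : Commute (1 + (r⁻¹ + Complex.I - Complex.I) • resolventOp A (r⁻¹ + Complex.I))
      (1 - (r⁻¹ + Complex.I - Complex.I) • resolventOp A Complex.I) := by
    refine Commute.add_left (Commute.one_left _) (Commute.sub_right (Commute.one_right _) ?_)
    exact ((hA.commute_resolventOp hz hI).smul_left _).smul_right _
  have h4 : IsUnit (1 - (r⁻¹ + Complex.I - Complex.I) • resolventOp A Complex.I) :=
    ⟨⟨_, _, h3.eq.symm.trans h1, h1⟩, rfl⟩
  refine hr (spectrum.mem_resolventSet_iff.mpr ?_)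
  have h5 : algebraMap ℂ (E →L[ℂ] E) r - resolventOp A Complex.I =
      r • (1 - (r⁻¹ + Complex.I - Complex.I) • resolventOp A Complex.I) := by
    rw [add_sub_cancel_right, smul_sub, smul_smul, mul_inv_cancel₀ hr0, one_smul,
      Algebra.algebraMap_eq_smul_one]
  rw [h5]
  exact (IsUnit.smul (Units.mk0 r hr0) h4 :)

/-- Every vector has a spectral measure. -/
theorem exists_isVectorSpectralMeasure (f : E) :
    ∃ μ : Measure ℝ, IsVectorSpectralMeasure A f μ := by
  have hI : Complex.I.im ≠ 0 := by simp
  set a := resolventOp A Complex.I with ha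
  have hn : IsStarNormal a := hA.isStarNormal_resolventOp hI
  have hcomp : CompactSpace (spectrum ℂ a) := isCompact_iff_compactSpace.mp (spectrum.isCompact a)
  obtain ⟨ν, hν, hint⟩ := exists_measure_inner_eq_integral (cfcHom (R := ℂ) hn) f
  -- The substitution `r = (x - i)⁻¹` is undone here; the point `r = 0` corresponds to `x = ∞` and
  -- is cut out by `s`.
  let x : spectrum ℂ a → ℝ := fun r => ((r : ℂ)⁻¹ + Complex.I).re
  have hx : Measurable x := by
    exact Complex.measurable_re.comp ((measurable_subtype_coe.inv).add_const _)
  let s : Set (spectrum ℂ a) := {r | (r : ℂ) ≠ 0}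
  have hs : MeasurableSet s := by
    exact (isOpen_ne.preimage continuous_subtype_val).measurableSet
  have hxr : ∀ r ∈ s, (x r : ℂ) = (r : ℂ)⁻¹ + Complex.I := fun r hr => by
    apply Complex.ext
    · simp [x]
    · rw [hA.im_inv_add_I_of_mem_spectrum r.2 hr, Complex.ofReal_im]
  refine ⟨(ν.restrict s).map x, inferInstance, fun z hz => ?_⟩
  have hd : ∀ r : spectrum ℂ a, 1 + (Complex.I - z) * (r : ℂ) ≠ 0 := fun r h => by
    rcases eq_or_ne (r : ℂ) 0 with h0 | h0
    · simp [h0] at h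
    · have h1 : (r : ℂ)⁻¹ + Complex.I = z := by
        field_simp
        linear_combination h
      exact hz (h1 ▸ hA.im_inv_add_I_of_mem_spectrum r.2 h0)
  -- This is `(x - z)⁻¹` in the variable `r`, extended by `0` to `r = 0`; hence cutting out that
  -- point does not change its integral.
  let g : C(spectrum ℂ a, ℂ) := ⟨fun r => (r : ℂ) / (1 + (Complex.I - z) * (r : ℂ)),
    by fun_prop (disch := exact hd _)⟩
  let i : C(spectrum ℂ a, ℂ) := (ContinuousMap.id ℂ).restrict (spectrum ℂ a)
  have hgi : g * (1 + (Complex.I - z) • i) = i := by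
    ext r
    have := hd r
    simp only [g, i, ContinuousMap.mul_apply, ContinuousMap.coe_mk, ContinuousMap.add_apply,
      ContinuousMap.one_apply, ContinuousMap.smul_apply, ContinuousMap.restrict_apply,
      ContinuousMap.id_apply, smul_eq_mul]
    exact div_mul_cancel₀ _ this
  -- Both sides solve `X (1 + (i - z) a) = a`, and that factor has a right inverse.
  have hΦ : cfcHom (R := ℂ) hn g = resolventOp A z := by
    have hΦi : cfcHom (R := ℂ) hn i = a := cfcHom_id hn
    have h1 := congrArg (cfcHom (R := ℂ) hn) hgi
    rw [map_mul, map_add, map_one, map_smul, hΦi] at h1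
    have h2 := (hA.isResolventAt_resolventOp hz).sub_eq (hA.isResolventAt_resolventOp hI)
    rw [← ha] at h2
    have h3 : resolventOp A z * (1 + (Complex.I - z) • a) = a := by
      rw [mul_add, mul_one, mul_smul_comm, ← neg_sub z, neg_smul, ← h2]
      abel
    have h4 := hA.one_add_mul_one_sub hI hz
    have h5 : (1 + (Complex.I - z) • a) * (1 - (Complex.I - z) • resolventOp A z) = 1 := h4
    calc _ = cfcHom (R := ℂ) hn g * ((1 + (Complex.I - z) • a) *
          (1 - (Complex.I - z) • resolventOp A z)) := by rw [h5, mul_one]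
      _ = resolventOp A z * ((1 + (Complex.I - z) • a) *
          (1 - (Complex.I - z) • resolventOp A z)) := by
            rw [← mul_assoc, h1, ← mul_assoc, h3]
      _ = _ := by rw [h5, mul_one]
  have hmeas : AEStronglyMeasurable (fun y : ℝ => ((y : ℂ) - z)⁻¹) ((ν.restrict s).map x) := by
    have : Measurable (fun y : ℝ => ((y : ℂ) - z)⁻¹) :=
      (Complex.measurable_ofReal.sub_const z).inv
    exact this.aestronglyMeasurable
  rw [← hΦ, hint, integral_map hx.aemeasurable hmeas]
  have h6 : ∫ r in s, ((x r : ℂ) - z)⁻¹ ∂ν = ∫ r in s, g r ∂ν := by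
    refine setIntegral_congr_fun hs fun r hr => ?_
    have hr' : (r : ℂ) ≠ 0 := hr
    have := hd r
    simp only [g, ContinuousMap.coe_mk]
    rw [hxr r hr, inv_eq_iff_eq_inv, inv_div]
    field_simp
    ring
  rw [h6, setIntegral_eq_integral_of_forall_compl_eq_zero]
  intro r hr
  have : (r : ℂ) = 0 := by_contra hr
  simp [g, this]

end IsMaxSymm

end Measures

/-! ### Point masses and eigenprojections -/

section Eigenspaces

open MeasureTheory Filter Topology

/-- The mass of a point is recovered from the Stieltjes transform. -/
theorem tendsto_stieltjes_singleton (μ : Measure ℝ) [IsFiniteMeasure μ] (l : ℝ) :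
    Tendsto (fun ε : ℝ => (-(ε * Complex.I)) * ∫ x : ℝ, ((x : ℂ) - (l + ε * Complex.I))⁻¹ ∂μ)
      (𝓝[>] 0) (𝓝 ((μ.real {l} : ℝ) : ℂ)) := by
  have h1 : ((μ.real {l} : ℝ) : ℂ) = ∫ x : ℝ, ({l} : Set ℝ).indicator (fun _ => (1 : ℂ)) x ∂μ := by
    rw [integral_indicator_const _ (measurableSet_singleton l)]
    simp
  simp_rw [h1, ← integral_const_mul]
  -- The integrand `-iε / (x - l - iε)` is bounded by `1` and tends to the indicator of `{l}`.
  refine tendsto_integral_filter_of_dominated_convergence (fun _ => 1) ?_ ?_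
    (integrable_const _) ?_
  · refine Eventually.of_forall fun ε => Measurable.aestronglyMeasurable ?_
    exact ((Complex.measurable_ofReal.sub_const _).inv).const_mul _
  · filter_upwards [self_mem_nhdsWithin] with ε hε
    refine Eventually.of_forall fun x => ?_
    have hε : 0 < ε := hε
    have h2 : ε ≤ ‖(x : ℂ) - (l + ε * Complex.I)‖ := by
      have := Complex.abs_im_le_norm ((x : ℂ) - (l + ε * Complex.I))
      simpa [abs_of_pos hε] using this
    rw [norm_mul, norm_inv, ← div_eq_mul_inv, div_le_one (hε.trans_le h2)]
    simpa [abs_of_pos hε] using h2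
  · refine Eventually.of_forall fun x => ?_
    rcases eq_or_ne x l with rfl | hx
    · refine Tendsto.congr' ?_ tendsto_const_nhds
      filter_upwards [self_mem_nhdsWithin] with ε hε
      have hε : (ε : ℂ) ≠ 0 := by exact_mod_cast (ne_of_gt hε : ε ≠ 0)
      simp only [Set.mem_singleton_iff, Set.indicator_of_mem]
      have : (x : ℂ) - (x + ε * Complex.I) = -(ε * Complex.I) := by ring
      rw [this, mul_inv_cancel₀]
      simpa using hε
    · have h3 : ({l} : Set ℝ).indicator (fun _ => (1 : ℂ)) x = 0 := by simp [hx]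
      rw [h3]
      have h4 : (x : ℂ) - (l + ((0 : ℝ) : ℂ) * Complex.I) ≠ 0 := by
        rw [Complex.ofReal_zero, zero_mul, add_zero, sub_ne_zero]
        exact_mod_cast hx
      have h5 : ContinuousAt (fun ε : ℝ => (-((ε : ℂ) * Complex.I)) *
          ((x : ℂ) - (l + ε * Complex.I))⁻¹) 0 := by
        refine ContinuousAt.mul (by fun_prop) (ContinuousAt.inv₀ (by fun_prop) h4)
      have h6 := h5.tendsto
      simp only [Complex.ofReal_zero, zero_mul, neg_zero] at h6
      exact h6.mono_left nhdsWithin_le_nhds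

variable {E : Type*} [NormedAddCommGroup E] [InnerProductSpace ℂ E]

/-- The eigenspace `ker (A - z)`. -/
def eigenspace (A : E →ₗ.[ℂ] E) (z : ℂ) : Submodule ℂ E :=
  (LinearMap.ker (A.toFun - z • A.domain.subtype)).map A.domain.subtype

theorem mem_eigenspace {A : E →ₗ.[ℂ] E} {z : ℂ} {f : E} :
    f ∈ eigenspace A z ↔ ∃ u : A.domain, (u : E) = f ∧ A u = z • f := by
  constructor
  · rintro ⟨u, hu, rfl⟩
    exact ⟨u, rfl, sub_eq_zero.mp hu⟩
  · rintro ⟨u, rfl, hu⟩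
    exact ⟨u, sub_eq_zero.mpr hu, rfl⟩

namespace IsMaxSymm

variable {A : E →ₗ.[ℂ] E} (hA : IsMaxSymm A)
include hA

theorem isClosed_eigenspace (z : ℂ) : IsClosed (eigenspace A z : Set E) := by
  refine IsSeqClosed.isClosed fun y g hy hg => ?_
  choose u hu hAu using fun k => mem_eigenspace.mp (hy k)
  obtain ⟨v, hv, hAv⟩ := hA.exists_of_tendsto (u := u) (x := g) (y := z • g)
    (by simpa only [hu] using hg) (by simpa only [hAu] using hg.const_smul z)
  exact mem_eigenspace.mpr ⟨v, hv, hAv⟩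

variable [CompleteSpace E]

theorem hasOrthogonalProjection_eigenspace (z : ℂ) :
    (eigenspace A z).HasOrthogonalProjection := by
  have : CompleteSpace (eigenspace A z) := (hA.isClosed_eigenspace z).completeSpace_coe
  infer_instance

theorem norm_resolventOp_le {z : ℂ} (hz : z.im ≠ 0) (g : E) :
    |z.im| * ‖resolventOp A z g‖ ≤ ‖g‖ := by
  obtain ⟨u, hu, hg⟩ := (hA.isResolventAt_resolventOp hz).2 g
  rw [← hu, ← hg]
  exact hA.im_mul_norm_le z u

theorem orthogonal_eigenspace_le (l : ℝ) :
    (eigenspace A l)ᗮ ≤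
      (LinearMap.range (A.toFun - (l : ℂ) • A.domain.subtype)).topologicalClosure := by
  rw [← Submodule.orthogonal_orthogonal_eq_closure]
  refine Submodule.orthogonal_le fun h hh => ?_
  refine mem_eigenspace.mpr (hA.maximal h ((l : ℂ) • h) fun u => ?_)
  have h1 := Submodule.inner_left_of_mem_orthogonal
    (LinearMap.mem_range_self (A.toFun - (l : ℂ) • A.domain.subtype) u) hh
  have h2 : (A.toFun - (l : ℂ) • A.domain.subtype) u = A u - (l : ℂ) • (u : E) := rfl
  rw [h2, inner_sub_right, inner_smul_right, sub_eq_zero] at h1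
  rw [h1, inner_smul_left, Complex.conj_ofReal]

/-- The operators `-iε (A - l - iε)⁻¹` are contractions, so it suffices to approximate `g` by
vectors `(A - l) u`. On these the resolvent gives `u + iε (A - l - iε)⁻¹ u`, of norm at most `2
‖u‖`, and the prefactor tends to `0`. -/
theorem tendsto_smul_resolventOp_of_orthogonal (l : ℝ) {g : E} (hg : g ∈ (eigenspace A l)ᗮ) :
    Tendsto (fun ε : ℝ => (-(ε * Complex.I)) • resolventOp A (l + ε * Complex.I) g)
      (𝓝[>] 0) (𝓝 0) := by
  have hb : ∀ ε : ℝ, 0 < ε → ∀ y : E,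
      ‖(-(ε * Complex.I)) • resolventOp A (l + ε * Complex.I) y‖ ≤ ‖y‖ := fun ε hε y => by
    have := hA.norm_resolventOp_le (z := l + ε * Complex.I) (by simpa using hε.ne') y
    rw [norm_smul]
    simpa [abs_of_pos hε] using this
  rw [Metric.tendsto_nhds]
  intro δ hδ
  obtain ⟨y, ⟨u, hu⟩, hy⟩ := Metric.mem_closure_iff.mp (hA.orthogonal_eigenspace_le l hg)
    (δ / 2) (by positivity)
  have hu : A u - (l : ℂ) • (u : E) = y := hu
  have h0 : Tendsto (fun ε : ℝ => ε * (2 * ‖(u : E)‖)) (𝓝[>] 0) (𝓝 0) := by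
    have : Tendsto (fun ε : ℝ => ε * (2 * ‖(u : E)‖)) (𝓝 0) (𝓝 (0 * (2 * ‖(u : E)‖))) :=
      tendsto_id.mul_const _
    rw [zero_mul] at this
    exact this.mono_left nhdsWithin_le_nhds
  filter_upwards [self_mem_nhdsWithin, h0.eventually_lt_const (half_pos hδ)] with ε hε hε2
  have hε : 0 < ε := hε
  set z : ℂ := l + ε * Complex.I with hz
  have hzim : z.im ≠ 0 := by simpa [hz] using hε.ne'
  have h1 : resolventOp A z y = u + (ε * Complex.I) • resolventOp A z u := by
    have h2 : y = (A u - z • (u : E)) + (ε * Complex.I) • (u : E) := by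
      rw [← hu, hz]; module
    rw [h2, map_add, (hA.isResolventAt_resolventOp hzim).1, map_smul]
  have h3 : ‖(-(ε * Complex.I)) • resolventOp A z y‖ ≤ ε * (2 * ‖(u : E)‖) := by
    rw [norm_smul, h1]
    have h4 := hb ε hε u
    rw [neg_smul, norm_neg] at h4
    have h5 := (norm_add_le (u : E) ((ε * Complex.I) • resolventOp A z u)).trans
      (add_le_add_right h4 _)
    have h6 : ‖-((ε : ℂ) * Complex.I)‖ = ε := by simp [abs_of_pos hε]
    rw [h6, two_mul]
    exact mul_le_mul_of_nonneg_left h5 hε.le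
  have h7 : (-(ε * Complex.I)) • resolventOp A z g =
      (-(ε * Complex.I)) • resolventOp A z (g - y) + (-(ε * Complex.I)) • resolventOp A z y := by
    rw [← smul_add, ← map_add, sub_add_cancel]
  rw [dist_zero_right, h7]
  have h8 := hb ε hε (g - y)
  rw [dist_eq_norm] at hy
  linarith [norm_add_le ((-(ε * Complex.I)) • resolventOp A z (g - y))
    ((-(ε * Complex.I)) • resolventOp A z y)]

theorem tendsto_smul_resolventOp (l : ℝ) [(eigenspace A l).HasOrthogonalProjection] (g : E) :
    Tendsto (fun ε : ℝ => (-(ε * Complex.I)) • resolventOp A (l + ε * Complex.I) g)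
      (𝓝[>] 0) (𝓝 ((eigenspace A l).starProjection g)) := by
  set p := (eigenspace A l).starProjection g with hp
  obtain ⟨u, hu, hAu⟩ := mem_eigenspace.mp ((eigenspace A l).starProjection_apply_mem g)
  rw [← hp] at hu hAu
  have h1 := (hA.tendsto_smul_resolventOp_of_orthogonal l
    ((eigenspace A l).sub_starProjection_mem_orthogonal g)).add_const p
  rw [zero_add] at h1
  refine h1.congr' ?_
  filter_upwards [self_mem_nhdsWithin] with ε hε
  have hε : 0 < ε := hε
  have hz : ((l : ℂ) + ε * Complex.I).im ≠ 0 := by simpa using hε.ne'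
  have h2 := (hA.isResolventAt_resolventOp hz).1 u
  have h3 : A u - ((l : ℂ) + ε * Complex.I) • (u : E) = (-(ε * Complex.I)) • p := by
    rw [hAu, hu]; module
  rw [h3, map_smul, hu] at h2
  rw [map_sub, smul_sub, ← hp, h2, sub_add_cancel]

theorem measureReal_singleton {f : E} {μ : Measure ℝ} (hμ : IsVectorSpectralMeasure A f μ)
    (l : ℝ) [(eigenspace A l).HasOrthogonalProjection] :
    ((μ.real {l} : ℝ) : ℂ) = ⟪f, (eigenspace A l).starProjection f⟫_ℂ := by
  have := hμ.1
  refine tendsto_nhds_unique (tendsto_stieltjes_singleton μ l) ?_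
  refine Tendsto.congr' ?_ (tendsto_const_nhds.inner (hA.tendsto_smul_resolventOp l f))
  filter_upwards [self_mem_nhdsWithin] with ε hε
  have hε : 0 < ε := hε
  rw [inner_smul_right, hμ.2 _ (by simpa using hε.ne')]

/-- The spectral measure of a point is the orthogonal projection onto the eigenspace. -/
theorem spectralMeasure_singleton (l : ℝ) [(eigenspace A l).HasOrthogonalProjection] :
    spectralMeasure A {l} = (eigenspace A l).starProjection := by
  have hex : ∃ P : E →L[ℂ] E, IsSpectralProjection A {l} P :=
    ⟨(eigenspace A l).starProjection, fun f => by
      obtain ⟨μ, hμ⟩ := hA.exists_isVectorSpectralMeasure f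
      exact ⟨μ, hμ, (hA.measureReal_singleton hμ l).symm⟩⟩
  rw [spectralMeasure, dif_pos hex]
  have h := hex.choose_spec
  set P := hex.choose
  -- On a complex space the quadratic form determines the operator, so whichever `P` was chosen is
  -- the projection.
  rw [← ContinuousLinearMap.coe_inj, ← ext_inner_map]
  intro f
  obtain ⟨μ, hμ, h1⟩ := h f
  rw [hA.measureReal_singleton hμ l] at h1
  have h2 := congrArg (starRingEnd ℂ) h1
  rwa [inner_conj_symm, inner_conj_symm] at h2

end IsMaxSymm

end Eigenspaces

/-! ### Openness of the resolvent set; bounded operators -/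

section Neumann

variable {E : Type*} [NormedAddCommGroup E] [InnerProductSpace ℂ E] [CompleteSpace E]

theorem IsResolventAt.exists_of_norm_lt {A : E →ₗ.[ℂ] E} {z w : ℂ} {R : E →L[ℂ] E}
    (h : IsResolventAt A z R) (hw : ‖(w - z) • R‖ < 1) :
    ∃ R' : E →L[ℂ] E, IsResolventAt A w R' := by
  -- Neumann series: `A - w = V (A - z)` with `V = 1 - (w - z) R`, so the new resolvent is `R V⁻¹`.
  let V := Units.oneSub ((w - z) • R) hw
  have hV : (V : E →L[ℂ] E) = 1 - (w - z) • R := rfl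
  have hc : Commute R (V : E →L[ℂ] E) := by
    rw [hV]
    exact Commute.sub_right (Commute.one_right _) ((Commute.refl _).smul_right _)
  have hc' : R * (↑V⁻¹ : E →L[ℂ] E) = (↑V⁻¹ : E →L[ℂ] E) * R := hc.units_inv_right.eq
  refine ⟨R * (↑V⁻¹ : E →L[ℂ] E), fun f => ?_, fun g => ?_⟩
  · have h1 : A f - w • (f : E) = (A f - z • (f : E)) - (w - z) • (f : E) := by module
    have h2 : R (A f - w • (f : E)) = (V : E →L[ℂ] E) f := by
      rw [h1, map_sub, h.1, map_smul, hV]; simp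
    rw [hc', mul_apply_eq_comp, h2, ← mul_apply_eq_comp, Units.inv_mul, one_apply_eq_self]
  · obtain ⟨f, hf, hg⟩ := h.2 ((↑V⁻¹ : E →L[ℂ] E) g)
    refine ⟨f, hf, ?_⟩
    have h1 : A f - w • (f : E) = (A f - z • (f : E)) - (w - z) • (f : E) := by module
    have h2 : ((V : E →L[ℂ] E) * (↑V⁻¹ : E →L[ℂ] E)) g = g := by simp
    rw [mul_apply_eq_comp, hV] at h2
    rw [h1, hg, hf]
    simpa using h2

theorem compl_spec_mem_nhds {A : E →ₗ.[ℂ] E} {z : ℂ} (hz : z ∉ spec A) : (spec A)ᶜ ∈ nhds z := by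
  obtain ⟨R, hR⟩ := not_not.mp hz
  have h1 : ContinuousAt (fun w : ℂ => ‖(w - z) • R‖) z := by fun_prop
  have h2 := h1.eventually_lt_const (u := 1) (by simp)
  filter_upwards [h2] with w hw
  exact not_not.mpr (hR.exists_of_norm_lt hw)

theorem isMaxSymm_ofBounded {T : E →L[ℂ] E} (hT : IsSelfAdjoint T) : IsMaxSymm (ofBounded T) := by
  have hs : ∀ x y : E, ⟪x, T y⟫_ℂ = ⟪T x, y⟫_ℂ := fun x y =>
    ((ContinuousLinearMap.isSelfAdjoint_iff_isSymmetric.mp hT) x y).symm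
  refine ⟨fun u v => hs u v, fun h k hk => ⟨⟨h, trivial⟩, rfl, ?_⟩⟩
  refine ext_inner_right ℂ fun v => ?_
  have := hk ⟨v, trivial⟩
  exact (hs h v).symm.trans this

theorem mem_eigenspace_ofBounded {E : Type*} [NormedAddCommGroup E] [InnerProductSpace ℂ E]
    {T : E →L[ℂ] E} {z : ℂ} {f : E} :
    f ∈ eigenspace (ofBounded T) z ↔ T f = z • f := by
  rw [mem_eigenspace]
  constructor
  · rintro ⟨u, rfl, hu⟩
    exact hu
  · intro h
    exact ⟨⟨f, trivial⟩, rfl, h⟩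

end Neumann

/-! ### Restrictions to kernels of boundary maps -/

section Restriction

variable {E F : Type*} [AddCommGroup E] [Module ℂ E] [AddCommGroup F] [Module ℂ F]

theorem exists_domRestrict_ker_iff {B : E →ₗ.[ℂ] E} (L : B.domain →ₗ[ℂ] F) {x y : E} :
    (∃ v : (B.domRestrict ((LinearMap.ker L).map B.domain.subtype)).domain, (v : E) = x ∧
      B.domRestrict ((LinearMap.ker L).map B.domain.subtype) v = y) ↔
    ∃ u : B.domain, (u : E) = x ∧ B u = y ∧ L u = 0 := by
  constructor
  · rintro ⟨⟨v, ⟨u, hu, rfl⟩, hv⟩, rfl, rfl⟩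
    exact ⟨u, rfl, (LinearPMap.domRestrict_apply rfl).symm, hu⟩
  · rintro ⟨u, rfl, rfl, hu⟩
    exact ⟨⟨u, ⟨u, hu, rfl⟩, u.2⟩, rfl, LinearPMap.domRestrict_apply rfl⟩

end Restriction

/-! ### Boundary triplets, γ-field and Weyl function -/

section Triplets

open Filter Topology

variable {H : Type*} [NormedAddCommGroup H] [InnerProductSpace ℂ H] [CompleteSpace H]
variable {G : Type*} [NormedAddCommGroup G] [InnerProductSpace ℂ G]

theorem exists_adjoint_of_inner {S : H →ₗ.[ℂ] H} (hS : Dense (S.domain : Set H)) {h k : H}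
    (hk : ∀ u : S.domain, ⟪h, S u⟫_ℂ = ⟪k, (u : H)⟫_ℂ) :
    ∃ v : S†.domain, (v : H) = h ∧ S† v = k :=
  ⟨⟨h, LinearPMap.mem_adjoint_domain_of_exists h ⟨k, fun u => (hk u).symm⟩⟩, rfl,
    LinearPMap.adjoint_apply_eq hS _ fun u => (hk u).symm⟩

namespace BoundaryTriplet

variable {S : H →ₗ.[ℂ] H} (t : BoundaryTriplet S G)

theorem exists_ext_iff {x y : H} : (∃ v : t.ext.domain, (v : H) = x ∧ t.ext v = y) ↔
    ∃ u : S†.domain, (u : H) = x ∧ S† u = y ∧ t.Γ' u = 0 :=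
  exists_domRestrict_ker_iff t.Γ'

theorem exists_refExt_iff {x y : H} : (∃ v : t.refExt.domain, (v : H) = x ∧ t.refExt v = y) ↔
    ∃ u : S†.domain, (u : H) = x ∧ S† u = y ∧ t.Γ u = 0 :=
  exists_domRestrict_ker_iff t.Γ

theorem exists_boundary (a b : G) : ∃ u : S†.domain, t.Γ u = a ∧ t.Γ' u = b := by
  obtain ⟨u, hu⟩ := t.surj (a, b)
  exact ⟨u, congrArg Prod.fst hu, congrArg Prod.snd hu⟩

/-- On `dom S` the left side of Green's identity vanishes against every `g`, and the boundary values
of `g` are arbitrary. -/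
theorem boundary_eq_zero (hS : IsClosedDenseSymmetric S) {u : S†.domain} {f : S.domain}
    (hu : (u : H) = f) : t.Γ u = 0 ∧ t.Γ' u = 0 := by
  have hle := hS.symmetric.le_adjoint hS.dense
  have hSu : S† u = S f := (hle.2 hu.symm).symm
  have key : ∀ g : S†.domain, ⟪t.Γ u, t.Γ' g⟫_ℂ = ⟪t.Γ' u, t.Γ g⟫_ℂ := fun g => by
    have h1 := (LinearPMap.adjoint_isFormalAdjoint hS.dense).symm f g
    rw [← sub_eq_zero, ← t.green, hSu, hu, h1, sub_self]
  constructor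
  · obtain ⟨g, hg, hg'⟩ := t.exists_boundary 0 (t.Γ u)
    have := key g
    rwa [hg, hg', inner_zero_right, inner_self_eq_zero] at this
  · obtain ⟨g, hg, hg'⟩ := t.exists_boundary (t.Γ' u) 0
    have := key g
    rw [hg, hg', inner_zero_right] at this
    exact inner_self_eq_zero.mp this.symm

theorem isMaxSymm_ext (hS : IsClosedDenseSymmetric S) : IsMaxSymm t.ext := by
  constructor
  · intro u v
    obtain ⟨u', hu, hu', hu0⟩ := t.exists_ext_iff.mp ⟨u, rfl, rfl⟩
    obtain ⟨v', hv, hv', hv0⟩ := t.exists_ext_iff.mp ⟨v, rfl, rfl⟩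
    have h1 := t.green u' v'
    rwa [hu0, hv0, inner_zero_left, inner_zero_right, sub_self, hu, hv, hu', hv',
      sub_eq_zero] at h1
  · intro h k hk
    have hle := hS.symmetric.le_adjoint hS.dense
    obtain ⟨w, hw, hw'⟩ := exists_adjoint_of_inner (h := h) (k := k) hS.dense fun f => by
      have hf : S† ⟨f, hle.1 f.2⟩ = S f := (hle.2 rfl).symm
      obtain ⟨v, hv, hv'⟩ := t.exists_ext_iff.mpr
        ⟨⟨f, hle.1 f.2⟩, rfl, hf, (t.boundary_eq_zero hS rfl).2⟩
      rw [← hv', hk v, hv]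
    refine t.exists_ext_iff.mpr ⟨w, hw, hw', ?_⟩
    -- This `g` lies in the domain of the extension, and Green's identity against it reduces to `‖Γ'
    -- w‖² = 0`.
    obtain ⟨g, hg, hg'⟩ := t.exists_boundary (t.Γ' w) 0
    obtain ⟨v, hv, hv'⟩ := t.exists_ext_iff.mpr ⟨g, rfl, rfl, hg'⟩
    have h1 := t.green w g
    rw [hg, hg', inner_zero_right, hw, hw', ← hv, ← hv', hk v, sub_self, zero_sub,
      zero_eq_neg, inner_self_eq_zero] at h1
    exact h1

/-- Green's identity for solutions of `S* f = z f` and `S* g = w g`. -/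
theorem green_of_eigen {z w : ℂ} {f g : S†.domain} (hf : S† f = z • (f : H))
    (hg : S† g = w • (g : H)) :
    (w - starRingEnd ℂ z) * ⟪(f : H), (g : H)⟫_ℂ = ⟪t.Γ f, t.Γ' g⟫_ℂ - ⟪t.Γ' f, t.Γ g⟫_ℂ := by
  rw [← t.green, hf, hg, inner_smul_left, inner_smul_right, sub_mul]

variable {t} in
theorem IsGammaAt.unique {z : ℂ} {g g' : G →L[ℂ] H} (h : t.IsGammaAt z g)
    (h' : t.IsGammaAt z g') : g = g' := by
  ext ξ
  obtain ⟨f, hf, hz, hΓ⟩ := h'.1 ξ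
  rw [← hf, ← h.2 f hz, hΓ]

variable [CompleteSpace G]

/-- On `ker (S* - z)`, a vector killed by `Γ` would be an eigenvector of `H⁰` at `z`. Any `g` with
`Γ g = ξ` is moved into that kernel by subtracting `(H⁰ - z)⁻¹ (S* - z) g`, which leaves `Γ g`
unchanged. Boundedness comes from the closed graph theorem. -/
theorem exists_isGammaAt (hS : IsClosedDenseSymmetric S) {z : ℂ} (hz : z ∉ spec t.refExt) :
    ∃ g : G →L[ℂ] H, t.IsGammaAt z g := by
  obtain ⟨R, hR⟩ := not_not.mp hz
  let N : Submodule ℂ S†.domain := LinearMap.ker (S†.toFun - z • S†.domain.subtype)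
  have hN : ∀ u : S†.domain, u ∈ N ↔ S† u = z • (u : H) := fun u => sub_eq_zero
  let L : N →ₗ[ℂ] G := t.Γ ∘ₗ N.subtype
  have hL : ∀ u : N, L u = t.Γ u := fun _ => rfl
  have hinj : Function.Injective L := by
    refine (injective_iff_map_eq_zero L).mpr fun u hu => ?_
    obtain ⟨v, hv, hv'⟩ := t.exists_refExt_iff.mpr ⟨u, rfl, (hN u).mp u.2, hu⟩
    have h1 := hR.1 v
    rw [hv', hv, sub_self, map_zero] at h1
    exact Subtype.ext (Subtype.ext h1.symm)
  have hsurj : Function.Surjective L := fun ξ => by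
    obtain ⟨g, hg, -⟩ := t.exists_boundary ξ 0
    obtain ⟨v, -, hv⟩ := hR.2 (S† g - z • (g : H))
    obtain ⟨w, hw, hw', hw0⟩ := t.exists_refExt_iff.mp ⟨v, rfl, rfl⟩
    refine ⟨⟨g - w, (hN _).mpr ?_⟩, ?_⟩
    · rw [LinearPMap.map_sub, hw', AddSubgroupClass.coe_sub, hw, ← sub_eq_zero]
      rw [← sub_eq_zero] at hv
      rw [← neg_eq_zero, ← hv]
      module
    · rw [hL, map_sub, hg, hw0, sub_zero]
  let e := LinearEquiv.ofBijective L ⟨hinj, hsurj⟩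
  let γ₀ : G →ₗ[ℂ] H := S†.domain.subtype ∘ₗ N.subtype ∘ₗ (e.symm : G →ₗ[ℂ] N)
  have hγ : ∀ ξ : G, ∃ f : S†.domain, (f : H) = γ₀ ξ ∧ S† f = z • (f : H) ∧ t.Γ f = ξ :=
    fun ξ => ⟨e.symm ξ, rfl, (hN _).mp (e.symm ξ).2, e.apply_symm_apply ξ⟩
  have hγ' : ∀ f : S†.domain, S† f = z • (f : H) → γ₀ (t.Γ f) = f := fun f hf => by
    have h1 : e.symm (L ⟨f, (hN f).mpr hf⟩) = ⟨f, (hN f).mpr hf⟩ := e.symm_apply_apply _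
    exact congrArg (fun u : N => ((u : S†.domain) : H)) h1
  have hcont : Continuous γ₀ := by
    refine γ₀.continuous_of_seq_closed_graph fun ξ x y hx hy => ?_
    have hy : Tendsto (fun k => γ₀ (ξ k)) atTop (𝓝 y) := hy
    choose f hf hfz hfΓ using fun k => hγ (ξ k)
    obtain ⟨v, hv, hv'⟩ := exists_adjoint_of_inner (h := y) (k := z • y) hS.dense fun u => by
      refine tendsto_nhds_unique (hy.inner tendsto_const_nhds)
        (((hy.const_smul z).inner tendsto_const_nhds).congr fun k => ?_)
      rw [← hf, ← hfz]
      exact LinearPMap.adjoint_isFormalAdjoint hS.dense (f k) u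
    have hvz : S† v = z • (v : H) := by rw [hv', hv]
    have hΓ : t.Γ v = x := by
      -- Green's identity against this `g` expresses `⟪ξ k, Γ v - x⟫` through `γ₀ (ξ k)`, so the
      -- limit can be taken although `Γ` is not known to be continuous.
      obtain ⟨g, hg, hg'⟩ := t.exists_boundary 0 (t.Γ v - x)
      have h1 : ∀ k, ⟪ξ k, t.Γ v - x⟫_ℂ =
          ⟪γ₀ (ξ k), S† g⟫_ℂ - ⟪z • γ₀ (ξ k), (g : H)⟫_ℂ := fun k => by
        have := t.green (f k) g
        rw [hg, hg', inner_zero_right, sub_zero, hfΓ, hfz, hf] at this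
        exact this.symm
      have h2 := t.green v g
      rw [hg, hg', inner_zero_right, sub_zero, hvz, hv] at h2
      have h3 : ⟪x, t.Γ v - x⟫_ℂ = ⟪t.Γ v, t.Γ v - x⟫_ℂ := by
        rw [← h2]
        refine tendsto_nhds_unique (hx.inner tendsto_const_nhds) ?_
        simp_rw [h1]
        exact (hy.inner tendsto_const_nhds).sub ((hy.const_smul z).inner tendsto_const_nhds)
      rw [← sub_eq_zero, ← inner_self_eq_zero (𝕜 := ℂ), inner_sub_left, h3, sub_self]
    rw [← hv, ← hγ' v hvz, hΓ]
  exact ⟨⟨γ₀, hcont⟩, hγ, hγ'⟩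

theorem isGammaAt_gamma (hS : IsClosedDenseSymmetric S) {z : ℂ} (hz : z ∉ spec t.refExt) :
    t.IsGammaAt z (t.gamma z) := by
  have h := t.exists_isGammaAt hS hz
  rw [gamma, dif_pos h]
  exact h.choose_spec

theorem isWeylAt_weyl (hS : IsClosedDenseSymmetric S) {x : ℝ} (hx : (x : ℂ) ∉ spec t.refExt) :
    t.IsWeylAt x (t.weyl x) := by
  have hγ := t.isGammaAt_gamma hS hx
  have hex : ∃ M : G →L[ℂ] G, t.IsWeylAt x M := by
    let γ₁ : G →ₗ[ℂ] S†.domain := (t.gamma x : G →ₗ[ℂ] H).codRestrict S†.domain fun ξ => by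
      obtain ⟨f, hf, -⟩ := hγ.1 ξ
      exact hf ▸ f.2
    have h1 : ∀ ξ, S† (γ₁ ξ) = (x : ℂ) • (γ₁ ξ : H) ∧ t.Γ (γ₁ ξ) = ξ := fun ξ => by
      obtain ⟨f, hf, hf'⟩ := hγ.1 ξ
      have : γ₁ ξ = f := Subtype.ext hf.symm
      rwa [this]
    let M₀ : G →ₗ[ℂ] G := t.Γ' ∘ₗ γ₁
    -- At a real point Green's identity makes `M₀` symmetric, and an everywhere defined symmetric
    -- operator is bounded (Hellinger–Toeplitz).
    have hM₀ : M₀.IsSymmetric := fun ξ η => by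
      have h2 := t.green_of_eigen (h1 ξ).1 (h1 η).1
      rw [Complex.conj_ofReal, sub_self, zero_mul, (h1 ξ).2, (h1 η).2] at h2
      exact (sub_eq_zero.mp h2.symm).symm
    exact ⟨⟨M₀, hM₀.continuous⟩, fun ξ => ⟨γ₁ ξ, rfl, rfl⟩⟩
  rw [weyl, dif_pos hex]
  exact hex.choose_spec

theorem gamma_spec (hS : IsClosedDenseSymmetric S) {x : ℝ} (hx : (x : ℂ) ∉ spec t.refExt) (ξ : G) :
    ∃ f : S†.domain, (f : H) = t.gamma x ξ ∧ S† f = (x : ℂ) • (f : H) ∧ t.Γ f = ξ ∧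
      t.Γ' f = t.weyl x ξ := by
  obtain ⟨f, hf, hfx, hfΓ⟩ := (t.isGammaAt_gamma hS hx).1 ξ
  obtain ⟨g, hg, hg'⟩ := t.isWeylAt_weyl hS hx ξ
  have : g = f := Subtype.ext (hg.trans hf.symm)
  exact ⟨f, hf, hfx, hfΓ, by rw [hg', this]⟩

theorem inner_gamma_gamma (hS : IsClosedDenseSymmetric S) {x y : ℝ}
    (hx : (x : ℂ) ∉ spec t.refExt) (hy : (y : ℂ) ∉ spec t.refExt) (ξ η : G) :
    ((y : ℂ) - x) * ⟪t.gamma x ξ, t.gamma y η⟫_ℂ = ⟪ξ, (t.weyl y - t.weyl x) η⟫_ℂ := by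
  obtain ⟨f, hf, hfx, hfΓ, hfΓ'⟩ := t.gamma_spec hS hx ξ
  obtain ⟨g, hg, hgy, hgΓ, hgΓ'⟩ := t.gamma_spec hS hy η
  obtain ⟨k, hk, hkx, hkΓ, hkΓ'⟩ := t.gamma_spec hS hx η
  have h1 := t.green_of_eigen hfx hgy
  have h2 := t.green_of_eigen hfx hkx
  rw [Complex.conj_ofReal, sub_self, zero_mul, hfΓ, hfΓ', hkΓ, hkΓ'] at h2
  rw [Complex.conj_ofReal, hf, hg, hfΓ, hfΓ', hgΓ, hgΓ', ← sub_eq_zero.mp h2.symm,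
    ← inner_sub_right] at h1
  exact h1

/-- The difference of the two solutions has zero `Γ`-value, so it lies in `dom H⁰`, where the
resolvent at `x` can be applied. -/
theorem gamma_sub_gamma (hS : IsClosedDenseSymmetric S) {x y : ℝ}
    (hy : (y : ℂ) ∉ spec t.refExt) {R : H →L[ℂ] H} (hR : IsResolventAt t.refExt x R) (η : G) :
    t.gamma y η - t.gamma x η = ((y : ℂ) - x) • R (t.gamma y η) := by
  have hx : (x : ℂ) ∉ spec t.refExt := not_not.mpr ⟨R, hR⟩
  obtain ⟨g, hg, hgy, hgΓ, -⟩ := t.gamma_spec hS hy η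
  obtain ⟨k, hk, hkx, hkΓ, -⟩ := t.gamma_spec hS hx η
  obtain ⟨v, hv, hv'⟩ := t.exists_refExt_iff.mpr
    ⟨g - k, rfl, rfl, by rw [map_sub, hgΓ, hkΓ, sub_self]⟩
  have h1 := hR.1 v
  rw [hv, hv', LinearPMap.map_sub, AddSubgroupClass.coe_sub, hgy, hkx, hg, hk] at h1
  rw [← h1, ← map_smul R]
  congr 1
  module

theorem tendsto_gamma (hS : IsClosedDenseSymmetric S) {x : ℝ} (hx : (x : ℂ) ∉ spec t.refExt)
    (η : G) : Tendsto (fun y : ℝ => t.gamma y η) (𝓝 x) (𝓝 (t.gamma x η)) := by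
  obtain ⟨R, hR⟩ := not_not.mp hx
  have hρ : ∀ᶠ y : ℝ in 𝓝 x, (y : ℂ) ∉ spec t.refExt :=
    Complex.continuous_ofReal.continuousAt.eventually (compl_spec_mem_nhds hx)
  have h0 : Tendsto (fun y : ℝ => ‖(y : ℂ) - x‖ * ‖R‖) (𝓝 x) (𝓝 0) := by
    have : ContinuousAt (fun y : ℝ => ‖(y : ℂ) - x‖ * ‖R‖) x := by fun_prop
    simpa using this.tendsto
  have h1 : Tendsto (fun y : ℝ => ‖(y : ℂ) - x‖ * ‖R‖ * (2 * ‖t.gamma x η‖)) (𝓝 x) (𝓝 0) := by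
    simpa using h0.mul_const (2 * ‖t.gamma x η‖)
  rw [tendsto_iff_norm_sub_tendsto_zero]
  refine squeeze_zero' (Eventually.of_forall fun _ => norm_nonneg _) ?_ h1
  -- Once `|y - x| ‖R‖ < 1/2`, `gamma_sub_gamma` gives `‖γ(y) η‖ ≤ 2 ‖γ(x) η‖`; only the resolvent
  -- at the fixed point `x` is involved.
  filter_upwards [hρ, h0.eventually_lt_const (u := 1 / 2) (by norm_num)] with y hy hy2
  have h2 : ‖t.gamma y η - t.gamma x η‖ ≤ ‖(y : ℂ) - x‖ * ‖R‖ * ‖t.gamma y η‖ := by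
    rw [t.gamma_sub_gamma hS hy hR, norm_smul, mul_assoc]
    exact mul_le_mul_of_nonneg_left (R.le_opNorm _) (norm_nonneg _)
  have h3 : ‖t.gamma y η‖ ≤ ‖t.gamma x η‖ + ‖t.gamma y η - t.gamma x η‖ := by
    simpa using norm_add_le (t.gamma x η) (t.gamma y η - t.gamma x η)
  have h4 := mul_le_mul_of_nonneg_right hy2.le (norm_nonneg (t.gamma y η))
  exact h2.trans (mul_le_mul_of_nonneg_left (by linarith) (by positivity))

theorem mem_eigenspace_ext_iff (hS : IsClosedDenseSymmetric S) {x : ℝ}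
    (hx : (x : ℂ) ∉ spec t.refExt) {f : H} :
    f ∈ eigenspace t.ext x ↔ ∃ ξ : G, t.weyl x ξ = 0 ∧ t.gamma x ξ = f := by
  rw [mem_eigenspace, exists_ext_iff]
  constructor
  · rintro ⟨u, rfl, hu, hu0⟩
    have h1 := (t.isGammaAt_gamma hS hx).2 u hu
    obtain ⟨g, hg, -, -, hg'⟩ := t.gamma_spec hS hx (t.Γ u)
    have : g = u := Subtype.ext (hg.trans h1)
    exact ⟨t.Γ u, by rw [← hg', this, hu0], h1⟩
  · rintro ⟨ξ, hξ, rfl⟩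
    obtain ⟨g, hg, hgx, -, hg'⟩ := t.gamma_spec hS hx ξ
    exact ⟨g, hg, by rw [hgx, hg], by rw [hg', hξ]⟩

/-- If the Weyl function is `(m - T) / n`, then `γ(x)* γ(x)` acts on `ker (T - m(x))` as
multiplication by `m'(x) / n(x)`. -/
theorem inner_gamma_of_eigen (hS : IsClosedDenseSymmetric S) {x : ℝ}
    (hx : (x : ℂ) ∉ spec t.refExt) {T : G →L[ℂ] G} {m n : ℂ → ℂ}
    (hm : DifferentiableAt ℂ m x) (hn : ContinuousAt n x) (hnx : n x ≠ 0)
    (hM : ∀ z ∉ spec t.refExt, n z ≠ 0 →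
      t.weyl z = (n z)⁻¹ • (m z • ContinuousLinearMap.id ℂ G - T))
    (ξ : G) {η : G} (hη : T η = m x • η) :
    ⟪t.gamma x ξ, t.gamma x η⟫_ℂ = deriv m x / n x * ⟪ξ, η⟫_ℂ := by
  have hρ : ∀ᶠ y : ℝ in 𝓝 x, (y : ℂ) ∉ spec t.refExt :=
    Complex.continuous_ofReal.continuousAt.eventually (compl_spec_mem_nhds hx)
  have hn' : ContinuousAt (fun y : ℝ => n y) x :=
    ContinuousAt.comp (g := n) hn Complex.continuous_ofReal.continuousAt
  have hn0 : ∀ᶠ y : ℝ in 𝓝 x, n y ≠ 0 := hn'.eventually_ne hnx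
  have h1 : Tendsto (fun y : ℝ => ⟪t.gamma x ξ, t.gamma y η⟫_ℂ) (𝓝[≠] x)
      (𝓝 ⟪t.gamma x ξ, t.gamma x η⟫_ℂ) :=
    (tendsto_const_nhds.inner (t.tendsto_gamma hS hx η)).mono_left nhdsWithin_le_nhds
  have h2 : Tendsto (fun y : ℝ => ((y : ℂ) - x)⁻¹ * (m y - m x)) (𝓝[≠] x) (𝓝 (deriv m x)) := by
    have h3 := hasDerivAt_iff_tendsto_slope.mp hm.hasDerivAt.comp_ofReal
    refine h3.congr fun y => ?_
    rw [slope_def_module, Complex.real_smul]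
    push_cast
    rfl
  have h4 : Tendsto (fun y : ℝ => ((y : ℂ) - x)⁻¹ * (m y - m x) / n y * ⟪ξ, η⟫_ℂ) (𝓝[≠] x)
      (𝓝 (deriv m x / n x * ⟪ξ, η⟫_ℂ)) :=
    (h2.div (hn'.tendsto.mono_left nhdsWithin_le_nhds) hnx).mul_const _
  refine tendsto_nhds_unique h1 (h4.congr' ?_)
  filter_upwards [hρ.filter_mono nhdsWithin_le_nhds, hn0.filter_mono nhdsWithin_le_nhds,
    self_mem_nhdsWithin] with y hy hny hyx
  have hyx' : (y : ℂ) - x ≠ 0 := sub_ne_zero.mpr (by exact_mod_cast hyx)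
  have h5 := t.inner_gamma_gamma hS hx hy ξ η
  have h6 : (t.weyl y - t.weyl x) η = ((m y - m x) / n y) • η := by
    rw [hM _ hy hny, hM _ hx hnx]
    simp only [sub_apply, smul_apply, ContinuousLinearMap.id_apply, hη]
    module
  rw [h6, inner_smul_right] at h5
  refine mul_left_cancel₀ hyx' ?_
  rw [h5]
  field_simp

end BoundaryTriplet

end Triplets

end SelfAdjExt

end

/-! ### The spectral projection at an eigenvalue of the extension -/

theorem proposition3
    {H : Type*} [NormedAddCommGroup H] [InnerProductSpace ℂ H] [CompleteSpace H]
    {G : Type*} [NormedAddCommGroup G] [InnerProductSpace ℂ G] [CompleteSpace G]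
    (S : H →ₗ.[ℂ] H) (hS : SelfAdjExt.IsClosedDenseSymmetric S)
    (t : SelfAdjExt.BoundaryTriplet S G)
    -- `J` is an open interval in a spectral gap of the reference operator
    (J : Set ℝ) (hJo : IsOpen J) (hJi : J.OrdConnected)
    (hJ : ∀ x ∈ J, (x : ℂ) ∉ SelfAdjExt.spec t.refExt)
    (T : G →L[ℂ] G) (hT : IsSelfAdjoint T)
    (m n : ℂ → ℂ)
    (hm : DifferentiableOn ℂ m (SelfAdjExt.spec t.refExt)ᶜ)
    (hn : DifferentiableOn ℂ n (SelfAdjExt.spec t.refExt)ᶜ)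
    (hnJ : ∀ x ∈ J, n (x : ℂ) ≠ 0)
    -- the Weyl function is `(m(z) - T) / n(z)`, wherever this quotient makes sense
    (hM : ∀ z ∉ SelfAdjExt.spec t.refExt, n z ≠ 0 →
      t.weyl z = (n z)⁻¹ • (m z • ContinuousLinearMap.id ℂ G - T))
    (l : ℝ) (hlJ : l ∈ J) (hl : l ∈ SelfAdjExt.pointSpec t.ext) :
    (m (l : ℂ)).im = 0 ∧ deriv m (l : ℂ) ≠ 0 ∧
      SelfAdjExt.spectralMeasure t.ext {l} =
        (n (l : ℂ) / deriv m (l : ℂ)) •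
          (t.gamma (l : ℂ) ∘L
            SelfAdjExt.spectralMeasure (SelfAdjExt.ofBounded T) {(m (l : ℂ)).re} ∘L
            ContinuousLinearMap.adjoint (t.gamma (l : ℂ))) := by
  have hρ := hJ l hlJ
  have hnl := hnJ l hlJ
  have hnhds := SelfAdjExt.compl_spec_mem_nhds hρ
  have key := fun ξ η hη => t.inner_gamma_of_eigen hS hρ (hm.differentiableAt hnhds)
    (hn.differentiableAt hnhds).continuousAt hnl hM ξ (η := η) hη
  have hker : ∀ ξ : G, t.weyl l ξ = 0 ↔ T ξ = m l • ξ := fun ξ => by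
    rw [hM _ hρ hnl]
    simp only [smul_apply, sub_apply, ContinuousLinearMap.id_apply, smul_eq_zero, inv_eq_zero,
      hnl, false_or, sub_eq_zero]
    exact eq_comm
  obtain ⟨v, hv0, hv⟩ := hl
  obtain ⟨ξ, hξ, hξv⟩ := (t.mem_eigenspace_ext_iff hS hρ).mp
    (SelfAdjExt.mem_eigenspace.mpr ⟨v, rfl, hv⟩)
  have hTξ := (hker ξ).mp hξ
  have hξ0 : ξ ≠ 0 := by
    rintro rfl
    exact hv0 (by rw [← hξv, map_zero])
  have hTs := ContinuousLinearMap.isSelfAdjoint_iff_isSymmetric.mp hT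
  have him : (m (l : ℂ)).im = 0 :=
    Complex.conj_eq_iff_im.mp (hTs.conj_eigenvalue_eq_self
      (Module.End.hasEigenvalue_of_hasEigenvector
        (Module.End.hasEigenvector_iff.mpr ⟨Module.End.mem_eigenspace_iff.mpr hTξ, hξ0⟩)))
  have hre : (((m (l : ℂ)).re : ℝ) : ℂ) = m l := Complex.ext rfl him.symm
  have hm' : deriv m (l : ℂ) ≠ 0 := fun h0 => by
    have h1 := key ξ ξ hTξ
    rw [h0, zero_div, zero_mul, inner_self_eq_zero, hξv] at h1
    exact hv0 h1
  refine ⟨him, hm', ?_⟩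
  have hA := t.isMaxSymm_ext hS
  have hB := SelfAdjExt.isMaxSymm_ofBounded hT
  have hPA := hA.hasOrthogonalProjection_eigenspace l
  have hPB := hB.hasOrthogonalProjection_eigenspace ((m (l : ℂ)).re : ℝ)
  rw [hA.spectralMeasure_singleton, hB.spectralMeasure_singleton]
  set K := SelfAdjExt.eigenspace (SelfAdjExt.ofBounded T) ((m (l : ℂ)).re : ℝ)
  have hK : ∀ η : G, η ∈ K ↔ T η = m l • η := fun η => by
    rw [SelfAdjExt.mem_eigenspace_ofBounded, hre]
  ext f
  set ζ := K.starProjection (ContinuousLinearMap.adjoint (t.gamma l) f) with hζ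
  have hζK : ζ ∈ K := K.starProjection_apply_mem _
  change _ = (n (l : ℂ) / deriv m (l : ℂ)) • t.gamma l ζ
  -- The projection is characterised by lying in the eigenspace with `f` minus it orthogonal to the
  -- eigenspace. For the latter, test against `γ(l) η` with `η ∈ K`: by `key` the factor `m' / n`
  -- cancels `n / m'`, and the projection onto `K` moves over to fix `η`.
  refine Submodule.eq_starProjection_of_mem_orthogonal ?_ ?_
  · exact Submodule.smul_mem _ _
      ((t.mem_eigenspace_ext_iff hS hρ).mpr ⟨ζ, (hker ζ).mpr ((hK ζ).mp hζK), rfl⟩)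
  · rw [Submodule.mem_orthogonal]
    intro e he
    obtain ⟨η, hη, rfl⟩ := (t.mem_eigenspace_ext_iff hS hρ).mp he
    have hηK : η ∈ K := (hK η).mpr ((hker η).mp hη)
    rw [inner_sub_right, inner_smul_right, key η ζ ((hK ζ).mp hζK), hζ,
      ← Submodule.inner_starProjection_left_eq_right,
      Submodule.starProjection_eq_self_iff.mpr hηK, ContinuousLinearMap.adjoint_inner_right]
    field_simp
    ring
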